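/- Let $K$ be a field, let $m,n$ be positive integers, let $S=K[x_{ij} : 1\le i\le m,\ 1\le j\le n]$ and let $X=(x_{ij})$ be the $m\times n$ matrix of variables. Let $I_2(X)\subseteq S$ be the ideal generated by the $2$-minors of $X$. For a total order on the set of variables, the induced reverse lexicographic term order on the monomials of $S$ is the one for which $x^a<x^b$ if and only if $\deg x^a<\deg x^b$, or $\deg x^a=\deg x^b$ and, for the smallest variable whose exponents in $x^a$ and $x^b$ differ, its exponent in $x^a$ is larger than its exponent in $x^b$. Then for every total order on the variables $x_{ij}$, the set of $2$-minors of $X$ is a Gröbner basis of $I_2(X)$ with respect to the induced reverse lexicographic term order; that is, it is a finite set of nonzero elements of $I_2(X)$ whose initial monomials generate the initial ideal $(\operatorname{in}(f) : f\in I_2(X)\setminus\{0\})$. -/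

import Mathlib

/-! ## Degree reverse lexicographic term orders -/

/-- A copy of the exponent vectors `σ →₀ ℕ`, to be ordered by the (degree) reverse lexicographic
order induced by the total order `r` of the variables. -/
def DegRevLex (σ : Type*) (_r : LinearOrder σ) : Type _ := σ →₀ ℕ

namespace DegRevLex

variable {σ : Type*} {r : LinearOrder σ}

noncomputable instance : AddCommMonoid (DegRevLex σ r) :=
  inferInstanceAs (AddCommMonoid (σ →₀ ℕ))

/-- The identity, from exponent vectors to their copy. -/
noncomputable def equiv (σ : Type*) (r : LinearOrder σ) : (σ →₀ ℕ) ≃+ DegRevLex σ r :=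
  AddEquiv.refl _

/-- Exponent vectors are compared first by total degree and then by the *reversed* comparison of
the exponents at the smallest variable (with respect to `r`) at which they differ. -/
noncomputable def key (a : DegRevLex σ r) : ℕ ×ₗ (Lex (σ →₀ ℕ))ᵒᵈ :=
  toLex (Finsupp.degree ((equiv σ r).symm a), OrderDual.toDual (toLex ((equiv σ r).symm a)))

theorem key_injective : Function.Injective (key (σ := σ) (r := r)) := fun _ _ h =>
  congrArg (fun p : ℕ ×ₗ (Lex (σ →₀ ℕ))ᵒᵈ => ofLex (OrderDual.ofDual (ofLex p).2)) h

noncomputable instance : LinearOrder (DegRevLex σ r) :=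
  LinearOrder.lift' key key_injective

/-- `x^a < x^b` iff `deg a < deg b`, or `deg a = deg b` and, for the smallest variable `i` at which
the exponents differ, `x_i` has the larger exponent in `x^a`. -/
theorem lt_iff {a b : σ →₀ ℕ} :
    equiv σ r a < equiv σ r b ↔
      a.degree < b.degree ∨
        (a.degree = b.degree ∧ ∃ i, (∀ j, r.lt j i → a j = b j) ∧ b i < a i) := by
  change key (equiv σ r a) < key (equiv σ r b) ↔ _
  rw [key, key, Prod.Lex.toLex_lt_toLex]
  simp only [AddEquiv.symm_apply_apply, OrderDual.toDual_lt_toDual]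
  refine or_congr Iff.rfl (and_congr Iff.rfl ?_)
  rw [Finsupp.Lex.lt_iff]
  exact exists_congr fun i => and_congr (forall_congr' fun j => imp_congr Iff.rfl eq_comm) Iff.rfl

instance : IsOrderedAddMonoid (DegRevLex σ r) where
  add_le_add_left a b h c := by
    rcases h.eq_or_lt with rfl | h
    · exact le_rfl
    · refine le_of_lt ?_
      obtain ⟨a, rfl⟩ := (equiv σ r).surjective a
      obtain ⟨b, rfl⟩ := (equiv σ r).surjective b
      obtain ⟨c, rfl⟩ := (equiv σ r).surjective c
      rw [← map_add, ← map_add, lt_iff]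
      rw [lt_iff] at h
      simpa using h

theorem equiv_monotone : Monotone (equiv σ r) := by
  intro a b h
  rcases h.eq_or_lt with rfl | h
  · exact le_rfl
  · obtain ⟨c, rfl⟩ := exists_add_of_le h.le
    refine (lt_iff.2 (Or.inl ?_)).le
    have hc : c ≠ 0 := by
      rintro rfl
      simp at h
    have : c.degree ≠ 0 := by simpa [Finsupp.degree_eq_zero_iff] using hc
    rw [map_add]
    omega

instance [Finite σ] : WellFoundedLT (DegRevLex σ r) := by
  refine ⟨RelEmbedding.wellFounded_iff_isEmpty.2 ⟨fun f => ?_⟩⟩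
  obtain ⟨i, j, hij, hle⟩ :=
    wellQuasiOrdered_le (α := σ →₀ ℕ) (fun k => (equiv σ r).symm (f k))
  have h1 : f i ≤ f j := by simpa using equiv_monotone (r := r) hle
  exact absurd (f.map_rel_iff.2 hij) (not_lt.2 h1)

end DegRevLex

/-- The reverse lexicographic term order on the monomials in finitely many variables indexed by
`σ`, induced by the total order `r` of the variables (`r.lt i j` means `x_i < x_j`). -/
noncomputable def MonomialOrder.degRevLex {σ : Type*} [Finite σ] (r : LinearOrder σ) :
    MonomialOrder σ where
  syn := DegRevLex σ r
  toSyn := DegRevLex.equiv σ r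
  toSyn_monotone := DegRevLex.equiv_monotone

/-! ## Initial ideals and Gröbner bases over a field -/

section Groebner

variable {σ K : Type*} [Field K]

/-- The initial monomial `in(f)`: the largest monomial that appears in `f` (meaningful for
`f ≠ 0`). -/
noncomputable def MonomialOrder.initialMonomial (ord : MonomialOrder σ) (f : MvPolynomial σ K) :
    MvPolynomial σ K :=
  MvPolynomial.monomial (ord.degree f) 1

/-- The initial ideal `in(I) = (in(f) : f ∈ I \ {0})`. -/
noncomputable def MonomialOrder.initialIdeal (ord : MonomialOrder σ)
    (I : Ideal (MvPolynomial σ K)) : Ideal (MvPolynomial σ K) :=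
  Ideal.span {g | ∃ f ∈ I, f ≠ 0 ∧ g = ord.initialMonomial f}

/-- `G` is a Gröbner basis of `I` with respect to `ord`: a finite set of nonzero elements of `I`
whose initial monomials generate the initial ideal of `I`. -/
structure MonomialOrder.IsGroebnerBasis (ord : MonomialOrder σ) (G : Set (MvPolynomial σ K))
    (I : Ideal (MvPolynomial σ K)) : Prop where
  finite : G.Finite
  subset : G ⊆ I
  ne_zero : ∀ g ∈ G, g ≠ 0
  span_eq : Ideal.span (ord.initialMonomial '' G) = ord.initialIdeal I

end Groebner

/-! ## Minors and determinantal ideals -/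

/-- The set of `t`-minors of a matrix: the determinants of its `t × t` submatrices, with row and
column indices taken in increasing order. -/
def Matrix.minorSet {R : Type*} [CommRing R] {m n : ℕ} (t : ℕ) (A : Matrix (Fin m) (Fin n) R) :
    Set R :=
  {f | ∃ (rows : Fin t ↪o Fin m) (cols : Fin t ↪o Fin n), f = (A.submatrix rows cols).det}

/-- The determinantal ideal `I_t(A)`, generated by the `t`-minors of `A`. -/
def Matrix.determinantalIdeal {R : Type*} [CommRing R] {m n : ℕ} (t : ℕ)
    (A : Matrix (Fin m) (Fin n) R) : Ideal R :=
  Ideal.span (A.minorSet t)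

/-! The Segre map `x_(i,j) ↦ y_i z_j` kills every `2`-minor, so it kills each nonzero `f` in the
ideal. The initial monomial `x^u` of `f` must cancel in the image, so `f` has a smaller monomial
`x^v` with the same row and column sums. Let `x_(i,j)` be the smallest variable where they differ;
there `v` exceeds `u`. Equal sums force `u` to exceed `v` at some `(i,l)` and some `(k,j)`, both
above `(i,j)`. Thus `x_(i,l) x_(k,j)` divides `x^u`, and it is the initial monomial, up to sign, of
a minor. Only the inclusion of the ideal in the Segre kernel is needed, and no S-pairs. -/

open MvPolynomial in
/-- A polynomial killed by a monomial substitution `x_i ↦ y^(e i)` has, besides any given monomial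
of its support, another one with the same image. -/
theorem MvPolynomial.exists_ne_mem_support_of_aeval_monomial_eq_zero {σ τ K : Type*} [Field K]
    (e : σ → τ →₀ ℕ) {f : MvPolynomial σ K}
    (hf : aeval (fun i => monomial (e i) (1 : K)) f = 0) {u : σ →₀ ℕ} (hu : u ∈ f.support) :
    ∃ v ∈ f.support, v ≠ u ∧
      (v.sum fun i k => k • e i) = u.sum fun i k => k • e i := by
  classical
  by_contra! h
  have key : ∀ a : σ →₀ ℕ, ∀ c : K, aeval (fun i => monomial (e i) (1 : K)) (monomial a c) =
      monomial (a.sum fun i k => k • e i) c := by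
    intro a c
    rw [aeval_monomial, monomial_finsupp_sum_index, algebraMap_eq]
    simp [monomial_pow]
  -- Under `h`, only `u` contributes to this coefficient of the image, so nothing cancels it.
  have h0 := congrArg (coeff (u.sum fun i k => k • e i)) hf
  rw [f.as_sum, map_sum, coeff_sum, Finset.sum_eq_single u] at h0
  · rw [key, coeff_monomial, if_pos rfl, coeff_zero] at h0
    exact mem_support_iff.1 hu h0
  · intro v hv hvu
    rw [key, coeff_monomial, if_neg (h v hv hvu)]
  · exact fun h => absurd hu h

section Margins

variable {α β : Type*}

/-- The exponent vector of the image of the variable `x_(i,j)` under the Segre map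
`x_(i,j) ↦ y_i z_j`. -/
noncomputable def segreExponent (p : α × β) : α ⊕ β →₀ ℕ :=
  Finsupp.single (Sum.inl p.1) 1 + Finsupp.single (Sum.inr p.2) 1

/-- The smallest of the four variables is `x_(i,j)` or `x_(k,l)`. Both divide the same term, which
is therefore the smaller one. -/
theorem DegRevLex.single_add_single_lt {r : LinearOrder (α × β)} {i k : α} {j l : β}
    (hik : i ≠ k) (hjl : j ≠ l) (h1 : r.lt (i, j) (i, l)) (h2 : r.lt (i, j) (k, j)) :
    DegRevLex.equiv _ r (Finsupp.single (i, j) 1 + Finsupp.single (k, l) 1) <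
      DegRevLex.equiv _ r (Finsupp.single (i, l) 1 + Finsupp.single (k, j) 1) := by
  classical
  refine DegRevLex.lt_iff.2 (Or.inr ⟨by simp, ?_⟩)
  have aux {p q : α × β} (h : r.lt p q) : q ≠ p := by
    rintro rfl; exact @lt_irrefl _ r.toPreorder _ h
  have aux' {p q s : α × β} (h : r.lt p q) (h' : r.lt q s) : r.lt p s :=
    @lt_trans _ r.toPreorder _ _ _ h h'
  rcases @lt_or_ge _ r (k, l) (i, j) with h | h
  · refine ⟨(k, l), fun p hp => ?_, by simp [hik, hjl.symm]⟩
    simp [aux hp, aux (aux' hp h), aux (aux' (aux' hp h) h1),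
      aux (aux' (aux' hp h) h2)]
  · refine ⟨(i, j), fun p hp => ?_, by simp [hik.symm, hjl.symm]⟩
    simp [aux hp, aux (@lt_of_lt_of_le _ r.toPreorder _ _ _ hp h),
      aux (aux' hp h1), aux (aux' hp h2)]

variable [Fintype α] [Fintype β]

theorem sum_segreExponent_inl (u : α × β →₀ ℕ) (i : α) :
    (u.sum fun p k => k • segreExponent p) (Sum.inl i) = ∑ j, u (i, j) := by
  classical
  rw [Finsupp.sum_fintype _ _ (by simp), Finsupp.finsetSum_apply, Fintype.sum_prod_type]
  simp only [segreExponent, Finsupp.smul_apply, Finsupp.add_apply, Finsupp.single_apply,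
    Sum.inl.injEq, reduceCtorEq, if_false, add_zero, smul_eq_mul, mul_ite, mul_one, mul_zero]
  rw [Finset.sum_eq_single i (fun b _ hb => by simp [hb]) (by simp)]
  simp

theorem sum_segreExponent_inr (u : α × β →₀ ℕ) (j : β) :
    (u.sum fun p k => k • segreExponent p) (Sum.inr j) = ∑ i, u (i, j) := by
  classical
  rw [Finsupp.sum_fintype _ _ (by simp), Finsupp.finsetSum_apply, Fintype.sum_prod_type]
  simp [segreExponent, Finsupp.single_apply]

theorem exists_lt_of_sum_eq_of_lt {ι : Type*} [Fintype ι] {u v : ι → ℕ}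
    (h : ∑ j, v j = ∑ j, u j) {j : ι} (hj : u j < v j) : ∃ l, v l < u l := by
  by_contra! hle
  exact (Finset.sum_lt_sum (fun l _ => hle l) ⟨j, Finset.mem_univ j, hj⟩).ne' h

/-- If `x^v` is smaller than `x^u` in the reverse lexicographic order and has the same row and
column sums, then `x^u` is divisible by the larger term of some `2`-minor. -/
theorem DegRevLex.exists_single_add_single_le {r : LinearOrder (α × β)} {u v : α × β →₀ ℕ}
    (hvu : DegRevLex.equiv _ r v < DegRevLex.equiv _ r u)
    (h : (v.sum fun p k => k • segreExponent p) = u.sum fun p k => k • segreExponent p) :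
    ∃ i j k l, i ≠ k ∧ j ≠ l ∧ r.lt (i, j) (i, l) ∧ r.lt (i, j) (k, j) ∧
      Finsupp.single (i, l) 1 + Finsupp.single (k, j) 1 ≤ u := by
  classical
  have hrow (i : α) : ∑ j, v (i, j) = ∑ j, u (i, j) := by
    rw [← sum_segreExponent_inl, h, sum_segreExponent_inl]
  have hcol (j : β) : ∑ i, v (i, j) = ∑ i, u (i, j) := by
    rw [← sum_segreExponent_inr, h, sum_segreExponent_inr]
  have hdeg : v.degree = u.degree := by
    simp only [Finsupp.degree_eq_sum, Fintype.sum_prod_type, hrow]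
  obtain hlt | ⟨-, ⟨i, j⟩, heq, hlt⟩ := DegRevLex.lt_iff.1 hvu
  · exact absurd hdeg hlt.ne
  -- Exponents agree below `(i, j)`, and at `(i, j)` itself `v` is the larger.
  have hbig (p : α × β) (hp : v p < u p) : r.lt (i, j) p := by
    rcases @lt_trichotomy _ r (i, j) p with h | h | h
    · exact h
    · subst h; omega
    · exact absurd (heq p h) hp.ne
  obtain ⟨l, hl⟩ := exists_lt_of_sum_eq_of_lt (hrow i) hlt
  obtain ⟨k, hk⟩ := exists_lt_of_sum_eq_of_lt (u := fun a => u (a, j)) (hcol j) hlt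
  have hjl : j ≠ l := by rintro rfl; omega
  have hik : i ≠ k := by rintro rfl; omega
  refine ⟨i, j, k, l, hik, hjl, hbig _ hl, hbig _ hk, fun p => ?_⟩
  simp only [Finsupp.add_apply, Finsupp.single_apply]
  split_ifs with h1 h2 h2
  · exact absurd (congrArg Prod.fst (h1.trans h2.symm)) hik
  · subst h1; omega
  · subst h2; omega
  · omega

end Margins

section TwoMinors

open MvPolynomial

variable {m n : ℕ}

theorem Matrix.exists_eq_of_mem_minorSet_two {R : Type*} [CommRing R]
    {A : Matrix (Fin m) (Fin n) R} {f : R} (hf : f ∈ A.minorSet 2) :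
    ∃ i j k l, i ≠ k ∧ j ≠ l ∧ f = A i j * A k l - A i l * A k j := by
  obtain ⟨rows, cols, rfl⟩ := hf
  refine ⟨rows 0, cols 0, rows 1, cols 1, by simp, by simp, ?_⟩
  simp [Matrix.det_fin_two]

/-- The term order, not the index order, selects `i, j, k, l`. Sorting rows and columns costs at
most a sign. -/
theorem Matrix.minor_two_or_neg_mem_minorSet {R : Type*} [CommRing R]
    (A : Matrix (Fin m) (Fin n) R) {i k : Fin m} {j l : Fin n} (hik : i ≠ k) (hjl : j ≠ l) :
    A i j * A k l - A i l * A k j ∈ A.minorSet 2 ∨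
      -(A i j * A k l - A i l * A k j) ∈ A.minorSet 2 := by
  have pair {q : ℕ} {a b : Fin q} (h : a < b) : ∃ g : Fin 2 ↪o Fin q, g 0 = a ∧ g 1 = b :=
    ⟨OrderEmbedding.ofStrictMono ![a, b] (by simpa [Fin.strictMono_iff_lt_succ] using h),
      by simp, by simp⟩
  rcases hik.lt_or_gt with hr | hr <;> rcases hjl.lt_or_gt with hc | hc <;>
    obtain ⟨rows, h0, h1⟩ := pair hr <;> obtain ⟨cols, h2, h3⟩ := pair hc
  · exact Or.inl ⟨rows, cols, by simp [Matrix.det_fin_two, *]⟩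
  · exact Or.inr ⟨rows, cols, by simp [Matrix.det_fin_two, *]⟩
  · exact Or.inr ⟨rows, cols, by simp [Matrix.det_fin_two, *]; ring⟩
  · exact Or.inl ⟨rows, cols, by simp [Matrix.det_fin_two, *]; ring⟩

theorem Matrix.finite_minorSet {R : Type*} [CommRing R] (t : ℕ) (A : Matrix (Fin m) (Fin n) R) :
    (A.minorSet t).Finite := by
  have : A.minorSet t = Set.range fun p : (Fin t ↪o Fin m) × (Fin t ↪o Fin n) =>
      (A.submatrix p.1 p.2).det := by
    ext f
    simp [Matrix.minorSet, eq_comm]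
  have : Finite (Fin t ↪o Fin m) := DFunLike.finite _
  have : Finite (Fin t ↪o Fin n) := DFunLike.finite _
  exact ‹A.minorSet t = _› ▸ Set.finite_range _

variable {K : Type*} [Field K]

theorem mvPolynomialX_mul (i k : Fin m) (j l : Fin n) :
    Matrix.mvPolynomialX (Fin m) (Fin n) K i j * Matrix.mvPolynomialX (Fin m) (Fin n) K k l =
      monomial (Finsupp.single (i, j) 1 + Finsupp.single (k, l) 1) 1 := by
  simp [Matrix.mvPolynomialX, X, monomial_mul]

theorem ne_zero_of_mem_minorSet_two {f : MvPolynomial (Fin m × Fin n) K}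
    (hf : f ∈ (Matrix.mvPolynomialX (Fin m) (Fin n) K).minorSet 2) : f ≠ 0 := by
  obtain ⟨i, j, k, l, hik, hjl, rfl⟩ := Matrix.exists_eq_of_mem_minorSet_two hf
  rw [mvPolynomialX_mul, mvPolynomialX_mul, sub_ne_zero]
  intro h
  -- The variable `x_(i,j)` divides only the first of the two terms.
  have h' := DFunLike.congr_fun (monomial_left_injective one_ne_zero h) (i, j)
  simp [hik.symm, hjl.symm] at h'

/-- Both terms of a minor map to `y_i y_k z_j z_l`. -/
theorem aeval_segreExponent_eq_zero {f : MvPolynomial (Fin m × Fin n) K}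
    (hf : f ∈ (Matrix.mvPolynomialX (Fin m) (Fin n) K).determinantalIdeal 2) :
    aeval (fun p => monomial (segreExponent p) (1 : K)) f = 0 := by
  suffices h : (Matrix.mvPolynomialX (Fin m) (Fin n) K).determinantalIdeal 2 ≤
      RingHom.ker (aeval (R := K) fun p : Fin m × Fin n => monomial (segreExponent p) (1 : K)) from
    h hf
  refine Ideal.span_le.2 fun g hg => ?_
  obtain ⟨i, j, k, l, -, -, rfl⟩ := Matrix.exists_eq_of_mem_minorSet_two hg
  simp only [SetLike.mem_coe, RingHom.mem_ker, map_sub, map_mul, Matrix.mvPolynomialX_apply,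
    aeval_X, monomial_mul, mul_one, segreExponent, sub_eq_zero]
  congr 2
  abel

theorem degree_minor_two {r : LinearOrder (Fin m × Fin n)} {i k : Fin m} {j l : Fin n}
    (hik : i ≠ k) (hjl : j ≠ l) (h1 : r.lt (i, j) (i, l)) (h2 : r.lt (i, j) (k, j)) :
    (MonomialOrder.degRevLex r).degree
      (Matrix.mvPolynomialX (Fin m) (Fin n) K i j * Matrix.mvPolynomialX (Fin m) (Fin n) K k l -
        Matrix.mvPolynomialX (Fin m) (Fin n) K i l * Matrix.mvPolynomialX (Fin m) (Fin n) K k j) =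
      Finsupp.single (i, l) 1 + Finsupp.single (k, j) 1 := by
  classical
  -- The subtracted term is the leading one, so the difference is negated first.
  rw [mvPolynomialX_mul, mvPolynomialX_mul, ← neg_sub, MonomialOrder.degree_neg,
    MonomialOrder.degree_sub_of_lt]
  · rw [MonomialOrder.degree_monomial, if_neg one_ne_zero]
  · rw [MonomialOrder.degree_monomial, MonomialOrder.degree_monomial, if_neg one_ne_zero,
      if_neg one_ne_zero]
    exact DegRevLex.single_add_single_lt hik hjl h1 h2

theorem exists_minor_two_degree_le {r : LinearOrder (Fin m × Fin n)}
    {f : MvPolynomial (Fin m × Fin n) K}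
    (hf : f ∈ (Matrix.mvPolynomialX (Fin m) (Fin n) K).determinantalIdeal 2) (hf0 : f ≠ 0) :
    ∃ g ∈ (Matrix.mvPolynomialX (Fin m) (Fin n) K).minorSet 2,
      (MonomialOrder.degRevLex r).degree g ≤ (MonomialOrder.degRevLex r).degree f := by
  obtain ⟨v, hv, hne, hsum⟩ := exists_ne_mem_support_of_aeval_monomial_eq_zero segreExponent
    (aeval_segreExponent_eq_zero hf)
    ((MonomialOrder.degRevLex r).degree_mem_support hf0)
  have hlt := lt_of_le_of_ne ((MonomialOrder.degRevLex r).le_degree hv)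
    fun h => hne ((MonomialOrder.degRevLex r).toSyn.injective h)
  obtain ⟨i, j, k, l, hik, hjl, h1, h2, hle⟩ := DegRevLex.exists_single_add_single_le hlt hsum
  rw [← degree_minor_two (K := K) hik hjl h1 h2] at hle
  rcases (Matrix.mvPolynomialX (Fin m) (Fin n) K).minor_two_or_neg_mem_minorSet hik hjl with h | h
  · exact ⟨_, h, hle⟩
  · exact ⟨_, h, by rwa [MonomialOrder.degree_neg]⟩

end TwoMinors

theorem proposition5p9 {K : Type*} [Field K] (m n : ℕ) (r : LinearOrder (Fin m × Fin n)) :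
    (MonomialOrder.degRevLex r).IsGroebnerBasis
      ((Matrix.mvPolynomialX (Fin m) (Fin n) K).minorSet 2)
      ((Matrix.mvPolynomialX (Fin m) (Fin n) K).determinantalIdeal 2) := by
  refine ⟨Matrix.finite_minorSet 2 _, Ideal.subset_span, fun g hg =>
    ne_zero_of_mem_minorSet_two hg, le_antisymm (Ideal.span_mono ?_) (Ideal.span_le.2 ?_)⟩
  · rintro _ ⟨g, hg, rfl⟩
    exact ⟨g, Ideal.subset_span hg, ne_zero_of_mem_minorSet_two hg, rfl⟩
  · rintro _ ⟨f, hf, hf0, rfl⟩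
    obtain ⟨g, hg, hle⟩ := exists_minor_two_degree_le (r := r) hf hf0
    refine Ideal.mem_of_dvd _ ?_ (Ideal.subset_span (Set.mem_image_of_mem _ hg))
    exact MvPolynomial.monomial_dvd_monomial.2 ⟨Or.inr hle, dvd_rfl⟩
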